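/- For $n\ge 2$ let $\mathcal K=X(K_{n+2})^{(n)}$ be the $n$-skeleton of the clique complex of the complete graph on $n+2$ vertices (the simplices are the nonempty vertex sets of size at most $n+1$; this is the boundary complex of the $(n+1)$-simplex). Let $\mathcal K_{n-1}$ be the set of its $(n-1)$-simplices and $N=|\mathcal K_{n-1}|$. An oriented $k$-simplex $\langle w_0\cdots w_k\rangle$ is an ordering of the vertices of a $k$-simplex modulo even permutations; $|\tau|$ denotes the underlying simplex of an oriented simplex $\tau$. For an oriented $n$-simplex $\sigma=\langle w_0\cdots w_n\rangle$ and an oriented $(n-1)$-simplex $\tau$ write $\sigma\triangleright\tau$ if $\tau=\langle w_{\pi(1)}\cdots w_{\pi(n)}\rangle$ for some even permutation $\pi$ of $\{0,\dots,n\}$, and let $\mathcal K^{n,n-1}=\{(\sigma,\tau):\sigma\triangleright\tau\}$, $E_\tau=\{(\sigma',\tau')\in\mathcal K^{n,n-1}:\tau'=\tau\}$ and $F_\sigma=\{(\sigma',\tau')\in\mathcal K^{n,n-1}:\sigma'=\sigma\}$. Here $|E_\tau|=2$ and $|F_\sigma|=n+1$. Fix a marked simplex $\tau_*\in\mathcal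 K_{n-1}$. On $\ell^2(\mathcal K^{n,n-1})=\bigoplus_\tau\ell^2(E_\tau)=\bigoplus_\sigma\ell^2(F_\sigma)$ put $$\hat U_*=\hat F\hat E_*,\qquad \hat E_*=\bigoplus_\tau\hat E_\tau,\qquad \hat F=\bigoplus_\sigma\hat F_\sigma,$$ where, in the standard bases, $\hat E_\tau=\begin{bmatrix}0&1\\1&0\end{bmatrix}$ if $|\tau|\ne\tau_*$, $\hat E_\tau=-I_2$ if $|\tau|=\tau_*$, and $\hat F_\sigma=\frac{2}{n+1}J_{n+1}-I_{n+1}$ is the Grover operator ($J_{n+1}$ is the all-ones matrix). Let $\psi_{IN}$ be the uniform state, $\psi_{IN}(\sigma,\tau)=\frac1{2\sqrt N}$ for all $(\sigma,\tau)\in\mathcal K^{n,n-1}$. Then there are times $t_f=t_f(n)\in\mathbb N$, not depending on $\tau_*$, with $t_f=O(n)$ and $t_f=O(\sqrt N)$ as $n\to\infty$, such that the probability of observing the marked simplex satisfies $$\sum_{(\sigma,\tau)\in\mathcal K^{n,n-1},\ |\tau|=\tau_*}\bigl|(\hat U_*^{\,t_f}\psi_{IN})(\sigma,\tau)\bigr|^2=1+o(1)\qquad(n\to\infty),$$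 uniformly in the choice of $\tau_*\in\mathcal K_{n-1}$. -/

import Mathlib

/-! ### Simplicial complexes -/

/-- The clique complex `X(G)`: its simplices are the nonempty finite cliques of `G`. -/
def SimpleGraph.cliqueComplex {V : Type*} (G : SimpleGraph V) : AbstractSimplicialComplex V where
  faces := {s | s.Nonempty ∧ G.IsClique (s : Set V)}
  isRelLowerSet_faces := fun {_} hs =>
    ⟨hs.1, fun _ hts ht => ⟨ht, hs.2.subset (Finset.coe_subset.mpr hts)⟩⟩
  singleton_mem v := ⟨Finset.singleton_nonempty v, by simp⟩

namespace AbstractSimplicialComplex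

/-- The `m`-skeleton: all simplices of dimension at most `m`, i.e. with at most `m + 1` vertices. -/
def skeleton {V : Type*} (K : AbstractSimplicialComplex V) (m : ℕ) :
    AbstractSimplicialComplex V where
  faces := {s | s ∈ K.faces ∧ s.card ≤ m + 1}
  isRelLowerSet_faces := fun {_} hs =>
    ⟨(K.isRelLowerSet_faces hs.1).1, fun _ hts ht =>
      ⟨(K.isRelLowerSet_faces hs.1).2 hts ht, (Finset.card_le_card hts).trans hs.2⟩⟩
  singleton_mem v := ⟨K.singleton_mem v, by simp⟩

end AbstractSimplicialComplex

/-! ### Oriented simplices and their induced primary faces -/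

namespace SimplicialWalk

variable {V : Type*}

/-- The (unoriented) simplices of `K` with exactly `m` vertices, i.e. of dimension `m - 1`. -/
abbrev Simplex (K : AbstractSimplicialComplex V) (m : ℕ) : Type _ :=
  {s : Finset V // s ∈ K.faces ∧ s.card = m}

/-- Orderings `(w₀, …, w_{m-1})` of the vertices of the simplices of `K` with `m` vertices. -/
structure OrderedSimplex (K : AbstractSimplicialComplex V) (m : ℕ) where
  vertex : Fin m → V
  injective : Function.Injective vertex
  mem_faces : Finset.univ.map ⟨vertex, injective⟩ ∈ K.faces

namespace OrderedSimplex

/-- The underlying vertex set of an ordered simplex. -/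
def support {K : AbstractSimplicialComplex V} {m : ℕ} (w : OrderedSimplex K m) : Finset V :=
  Finset.univ.map ⟨w.vertex, w.injective⟩

/-- Two orderings are equivalent if they differ by an even permutation. -/
instance setoid (K : AbstractSimplicialComplex V) (m : ℕ) : Setoid (OrderedSimplex K m) where
  r w w' := ∃ π ∈ alternatingGroup (Fin m), w'.vertex = w.vertex ∘ π
  iseqv :=
    { refl := fun _ => ⟨1, one_mem _, rfl⟩
      symm := by
        rintro w w' ⟨π, hπ, h⟩
        refine ⟨π⁻¹, inv_mem hπ, ?_⟩
        rw [h]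
        funext i
        simp
      trans := by
        rintro w w' w'' ⟨π, hπ, h⟩ ⟨ρ, hρ, h'⟩
        refine ⟨π * ρ, mul_mem hπ hρ, ?_⟩
        rw [h', h]
        rfl }

theorem support_eq_of_equiv {K : AbstractSimplicialComplex V} {m : ℕ}
    (w w' : OrderedSimplex K m) (h : w ≈ w') : w.support = w'.support := by
  obtain ⟨π, -, h⟩ := h
  ext v
  simp only [support, Finset.mem_map, Finset.mem_univ, true_and, Function.Embedding.coeFn_mk, h,
    Function.comp_apply]
  exact ⟨fun ⟨i, hi⟩ => ⟨π⁻¹ i, by simpa using hi⟩, fun ⟨i, hi⟩ => ⟨π i, hi⟩⟩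

end OrderedSimplex

/-- Oriented simplices `⟨w₀ ⋯ w_{m-1}⟩` of `K` with `m` vertices: orderings of the vertices modulo
even permutations. -/
def OrientedSimplex (K : AbstractSimplicialComplex V) (m : ℕ) : Type _ :=
  Quotient (OrderedSimplex.setoid K m)

/-- The support `|τ|` of an oriented simplex `τ`. -/
def OrientedSimplex.support {K : AbstractSimplicialComplex V} {m : ℕ}
    (τ : OrientedSimplex K m) : Finset V :=
  Quotient.lift OrderedSimplex.support OrderedSimplex.support_eq_of_equiv τ

/-- `σ ▷ τ`: the oriented `(n-1)`-simplex `τ` is an induced directed primary face of the oriented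
`n`-simplex `σ = ⟨w₀ ⋯ wₙ⟩`, that is, `τ = ⟨w_{π(1)} ⋯ w_{π(n)}⟩` for an even permutation `π`
of `{0, …, n}`. -/
def InducedFace {K : AbstractSimplicialComplex V} {n : ℕ}
    (σ : OrientedSimplex K (n + 1)) (τ : OrientedSimplex K n) : Prop :=
  ∃ (w : OrderedSimplex K (n + 1)) (u : OrderedSimplex K n),
    (Quotient.mk _ w : OrientedSimplex K (n + 1)) = σ ∧
    (Quotient.mk _ u : OrientedSimplex K n) = τ ∧
    ∃ π ∈ alternatingGroup (Fin (n + 1)), u.vertex = Fin.tail (w.vertex ∘ π)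

/-! ### Simplicial quantum walks -/

/-- The set `K^{n,n-1}` of pairs `(σ, τ)` of an oriented `n`-simplex and an oriented
`(n-1)`-simplex with `σ ▷ τ`. -/
@[ext]
structure Flag (K : AbstractSimplicialComplex V) (n : ℕ) where
  σ : OrientedSimplex K (n + 1)
  τ : OrientedSimplex K n
  face : InducedFace σ τ

section Finiteness

variable [Finite V] (K : AbstractSimplicialComplex V)

instance (m : ℕ) : Finite (OrderedSimplex K m) :=
  Finite.of_injective OrderedSimplex.vertex fun w w' h => by
    cases w; cases w'; cases h; rfl

instance (m : ℕ) : Finite (OrientedSimplex K m) :=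
  inferInstanceAs (Finite (Quotient _))

instance (n : ℕ) : Finite (Flag K n) :=
  Finite.of_injective (fun x : Flag K n => (x.σ, x.τ)) fun _ _ h =>
    Flag.ext (congrArg Prod.fst h) (congrArg Prod.snd h)

noncomputable instance (n : ℕ) : Fintype (Flag K n) := Fintype.ofFinite _

end Finiteness

noncomputable instance (K : AbstractSimplicialComplex V) (n : ℕ) : DecidableEq (Flag K n) :=
  Classical.decEq _

/-- `E_τ`, the set of pairs of `K^{n,n-1}` with second component `τ`. -/
abbrev EFiber {K : AbstractSimplicialComplex V} {n : ℕ} (τ : OrientedSimplex K n) : Type _ :=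
  {x : Flag K n // x.τ = τ}

/-- `F_σ`, the set of pairs of `K^{n,n-1}` with first component `σ`. -/
abbrev FFiber {K : AbstractSimplicialComplex V} {n : ℕ} (σ : OrientedSimplex K (n + 1)) : Type _ :=
  {x : Flag K n // x.σ = σ}

open Classical in
/-- The matrix, in the standard basis of `ℓ²(K^{n,n-1})`, of the direct sum `⨁_τ E_τ` of local
operators, each given by its matrix in the standard basis indexed by the fibre of `τ`. -/
noncomputable def firstMatrix {K : AbstractSimplicialComplex V} {n : ℕ}
    (E : (τ : OrientedSimplex K n) → Matrix (EFiber τ) (EFiber τ) ℂ) :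
    Matrix (Flag K n) (Flag K n) ℂ :=
  fun x y => if h : y.τ = x.τ then E x.τ ⟨x, rfl⟩ ⟨y, h⟩ else 0

open Classical in
/-- The matrix, in the standard basis of `ℓ²(K^{n,n-1})`, of the direct sum `⨁_σ F_σ` of local
operators, each given by its matrix in the standard basis indexed by the fibre of `σ`. -/
noncomputable def secondMatrix {K : AbstractSimplicialComplex V} {n : ℕ}
    (F : (σ : OrientedSimplex K (n + 1)) → Matrix (FFiber σ) (FFiber σ) ℂ) :
    Matrix (Flag K n) (Flag K n) ℂ :=
  fun x y => if h : y.σ = x.σ then F x.σ ⟨x, rfl⟩ ⟨y, h⟩ else 0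

/-- The time evolution `U = F ∘ E` of a simplicial quantum walk on `ℓ²(K^{n,n-1})`. -/
noncomputable def evolution [Finite V] {K : AbstractSimplicialComplex V} {n : ℕ}
    (F : (σ : OrientedSimplex K (n + 1)) → Matrix (FFiber σ) (FFiber σ) ℂ)
    (E : (τ : OrientedSimplex K n) → Matrix (EFiber τ) (EFiber τ) ℂ) :
    EuclideanSpace ℂ (Flag K n) →ₗ[ℂ] EuclideanSpace ℂ (Flag K n) :=
  Matrix.toEuclideanLin (secondMatrix F) ∘ₗ Matrix.toEuclideanLin (firstMatrix E)

open Classical in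
/-- The probability that the state `ψ` is observed at the unoriented `(n-1)`-simplex `s`. -/
noncomputable def observeProb [Finite V] {K : AbstractSimplicialComplex V} {n : ℕ}
    (ψ : EuclideanSpace ℂ (Flag K n)) (s : Simplex K n) : ℝ :=
  ∑ x : Flag K n with x.τ.support = s.1, ‖ψ x‖ ^ 2

/-! ### The search walk -/

open Classical in
/-- The local operator at `τ`: minus the identity if `|τ|` is the marked simplex `s`; otherwise the
flip, with entries `0` on and `1` off the diagonal. -/
noncomputable def searchE {K : AbstractSimplicialComplex V} {n : ℕ} (s : Simplex K n)
    (τ : OrientedSimplex K n) : Matrix (EFiber τ) (EFiber τ) ℂ :=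
  if τ.support = s.1 then -1 else Matrix.of fun x y => if x = y then 0 else 1

/-- The local `(n+1)`-dimensional Grover operator `(2/(n+1)) J - I` at `σ`. -/
noncomputable def groverF {K : AbstractSimplicialComplex V} {n : ℕ}
    (σ : OrientedSimplex K (n + 1)) : Matrix (FFiber σ) (FFiber σ) ℂ :=
  (2 / ((n : ℂ) + 1)) • Matrix.of (fun _ _ => 1) - 1

/-- The search operator `U_* = F E_*` with marked simplex `s`. -/
noncomputable def searchEvolution [Finite V] {K : AbstractSimplicialComplex V} {n : ℕ}
    (s : Simplex K n) : EuclideanSpace ℂ (Flag K n) →ₗ[ℂ] EuclideanSpace ℂ (Flag K n) :=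
  evolution groverF (searchE s)

/-- The uniform state `1 / (2 √N)` on `K^{n,n-1}`, with `N` the number of `(n-1)`-simplices. -/
noncomputable def uniformState (K : AbstractSimplicialComplex V) (n : ℕ) :
    EuclideanSpace ℂ (Flag K n) :=
  WithLp.toLp 2 fun _ => ((1 / (2 * √(Nat.card (Simplex K n) : ℝ)) : ℝ) : ℂ)

/-- The complex `X(K_{n+2})^{(n)}`, the `n`-skeleton of the clique complex of the complete graph on
`n + 2` vertices. -/
def sphereComplex (n : ℕ) : AbstractSimplicialComplex (Fin (n + 2)) :=
  (SimpleGraph.completeGraph (Fin (n + 2))).cliqueComplex.skeleton n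

end SimplicialWalk

/-! An `n`-simplex omits one vertex `a`, and a face of it drops a further vertex `v`. So, up to
orientation, a flag is an arc `(a, v)` of the complete graph on `n + 2` vertices. The flip at an
unmarked face reverses the arc, and the Grover operator mixes the `n + 1` arcs leaving `a`. The
marked simplex `s` omits two vertices, and amplitudes that are constant on the four classes of arcs
given by `a ∈ s` and `v ∈ s` stay so. The uniform state is of this form, so the search reduces
exactly to the isometry `searchStep` of a four-dimensional Euclidean space.

In orthonormal coordinates the couplings `α`, `β` of this isometry are of order `h = 1 / √(n + 1)`.
At `α = β = 0` (and `a = b = 0`) it fixes the marked coordinate `v 0` and the bulk coordinate `v 3`,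
and turns the plane of `v 1`, `v 2` by a quarter. For small couplings the fast coordinates are
slaved to the slow ones: solving `v 1 = v 2 - α * sin θ`, `v 2 = -v 1 + β * cos θ` gives the middle
entries of `slowCurve`. Substituting them back rotates `(v 0, v 3) = (sin θ, cos θ)` by the angle `α
* β / 2`, of order `1 / n`, with error `O(h ^ 3)` per step (`dist_reducedStep_slowCurve_le`).

An isometry does not amplify errors, so over `O(n) = O(h ^ (-2))` steps they add up to `O(h)`
(`dist_iterate_le`). The uniform state is within `O(h)` of the curve at `θ = 0`
(`dist_uniformCoords_le`). Stopping when `θ` is next to `π / 2` leaves the marked coordinate within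
`O(h)` of `1`. Since `N = (n + 1) * (n + 2) / 2`, the orders `n` and `√N` agree. -/

namespace SimplicialWalk

/-! ### Orientations and induced faces in an arbitrary complex -/

section General

variable {V : Type*} {K : AbstractSimplicialComplex V} {n m : ℕ}

theorem OrderedSimplex.ext_vertex {w w' : OrderedSimplex K m} (h : w.vertex = w'.vertex) :
    w = w' := by
  cases w; cases w'; cases h; rfl

theorem OrderedSimplex.mem_support {w : OrderedSimplex K m} {v : V} :
    v ∈ w.support ↔ ∃ i, w.vertex i = v := by
  simp [OrderedSimplex.support]

theorem OrderedSimplex.card_support (w : OrderedSimplex K m) : w.support.card = m := by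
  simp [OrderedSimplex.support]

theorem OrientedSimplex.support_mk (w : OrderedSimplex K m) :
    OrientedSimplex.support (Quotient.mk _ w : OrientedSimplex K m) = w.support := rfl

theorem OrientedSimplex.card_support (τ : OrientedSimplex K m) : τ.support.card = m := by
  induction τ using Quotient.inductionOn with
  | h w => exact w.card_support

theorem OrientedSimplex.mk_eq_mk {w w' : OrderedSimplex K m} :
    (Quotient.mk _ w : OrientedSimplex K m) = Quotient.mk _ w' ↔
      ∃ π ∈ alternatingGroup (Fin m), w'.vertex = w.vertex ∘ π :=
  Quotient.eq

/-- Reordering the vertices of an ordered simplex. -/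
def OrderedSimplex.reorder (w : OrderedSimplex K m) (π : Equiv.Perm (Fin m)) :
    OrderedSimplex K m where
  vertex := w.vertex ∘ π
  injective := w.injective.comp π.injective
  mem_faces := by
    convert w.mem_faces using 1
    ext v
    simp only [Finset.mem_map, Finset.mem_univ, true_and, Function.Embedding.coeFn_mk,
      Function.comp_apply]
    exact ⟨fun ⟨i, hi⟩ => ⟨π i, hi⟩, fun ⟨i, hi⟩ => ⟨π⁻¹ i, by simpa using hi⟩⟩

theorem OrderedSimplex.support_reorder (w : OrderedSimplex K m) (π : Equiv.Perm (Fin m)) :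
    (w.reorder π).support = w.support := by
  ext v
  simp only [mem_support, reorder, Function.comp_apply]
  exact ⟨fun ⟨i, hi⟩ => ⟨π i, hi⟩, fun ⟨i, hi⟩ => ⟨π⁻¹ i, by simpa using hi⟩⟩

/-- The permutation of `Fin (n + 1)` fixing `0` and acting as `e` on the successors. -/
theorem exists_extend_perm {e : Equiv.Perm (Fin n)} (he : e ∈ alternatingGroup (Fin n)) :
    ∃ π ∈ alternatingGroup (Fin (n + 1)), π 0 = 0 ∧ ∀ i : Fin n, π i.succ = (e i).succ := by
  refine ⟨Equiv.Perm.decomposeFin.symm (0, e), ?_, ?_, ?_⟩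
  · rw [Equiv.Perm.mem_alternatingGroup] at he ⊢
    simp [he]
  · simp
  · intro i
    simp

theorem exists_restrict_perm {π : Equiv.Perm (Fin (n + 1))}
    (hπ : π ∈ alternatingGroup (Fin (n + 1))) (h0 : π 0 = 0) :
    ∃ e ∈ alternatingGroup (Fin n), ∀ i : Fin n, π i.succ = (e i).succ := by
  obtain ⟨⟨p, e⟩, rfl⟩ := Equiv.Perm.decomposeFin.symm.surjective π
  have hp : p = 0 := by simpa using h0
  subst hp
  refine ⟨e, ?_, fun i => by simp⟩
  rw [Equiv.Perm.mem_alternatingGroup] at hπ ⊢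
  simpa using hπ

/-- A third index exists because `n ≥ 2`, so a 3-cycle does it. This is what gives each oriented
simplex an induced orientation on every primary face. -/
theorem exists_even_perm_zero (hn : 2 ≤ n) (i : Fin (n + 1)) :
    ∃ π ∈ alternatingGroup (Fin (n + 1)), π 0 = i := by
  by_cases hi : i = 0
  · exact ⟨1, one_mem _, by simp [hi]⟩
  · obtain ⟨j, hj⟩ : ∃ j : Fin (n + 1), j ∉ ({0, i} : Finset (Fin (n + 1))) := by
      by_contra! h
      have h1 := Finset.card_le_card (fun j _ => h j : Finset.univ ⊆ _)
      have h2 := Finset.card_le_two (a := (0 : Fin (n + 1))) (b := i)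
      simp only [Finset.card_univ, Fintype.card_fin] at h1
      omega
    simp only [Finset.mem_insert, Finset.mem_singleton, not_or] at hj
    refine ⟨Equiv.swap 0 i * Equiv.swap i j, ?_, ?_⟩
    · rw [Equiv.Perm.mem_alternatingGroup, map_mul, Equiv.Perm.sign_swap (Ne.symm hi),
        Equiv.Perm.sign_swap (Ne.symm hj.2)]
      rfl
    · rw [Equiv.Perm.mul_apply, Equiv.swap_apply_of_ne_of_ne (Ne.symm hi) (Ne.symm hj.1),
        Equiv.swap_apply_left]

/-- The even permutations in the definition can all be absorbed into the representative of `σ`,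
since an even permutation of the face extends by fixing `0`. -/
theorem inducedFace_mk_iff {σ : OrientedSimplex K (n + 1)} {u : OrderedSimplex K n} :
    InducedFace σ (Quotient.mk _ u : OrientedSimplex K n) ↔
      ∃ w : OrderedSimplex K (n + 1), (Quotient.mk _ w : OrientedSimplex K (n + 1)) = σ ∧
        Fin.tail w.vertex = u.vertex := by
  constructor
  · rintro ⟨w, u', rfl, hu, π, hπ, h⟩
    obtain ⟨e, he, hue⟩ := OrientedSimplex.mk_eq_mk.1 hu
    obtain ⟨ρ, hρ, hρ0, hρs⟩ := exists_extend_perm he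
    refine ⟨w.reorder (π * ρ), ?_, ?_⟩
    · symm
      exact OrientedSimplex.mk_eq_mk.2 ⟨π * ρ, mul_mem hπ hρ, rfl⟩
    · funext i
      have h1 := congrFun hue i
      rw [h1, Function.comp_apply, congrFun h (e i)]
      simp [Fin.tail, OrderedSimplex.reorder, hρs]
  · rintro ⟨w, rfl, h⟩
    exact ⟨w, u, rfl, rfl, 1, one_mem _, by simp [h]⟩

theorem OrderedSimplex.support_eq_insert [DecidableEq V] {w : OrderedSimplex K (n + 1)}
    {u : OrderedSimplex K n} (h : Fin.tail w.vertex = u.vertex) :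
    w.support = insert (w.vertex 0) u.support := by
  ext v
  simp only [mem_support, Finset.mem_insert, Fin.exists_fin_succ, ← h, Fin.tail, eq_comm (a := v)]

theorem OrderedSimplex.zero_notMem_support {w : OrderedSimplex K (n + 1)}
    {u : OrderedSimplex K n} (h : Fin.tail w.vertex = u.vertex) :
    w.vertex 0 ∉ u.support := by
  rw [mem_support]
  rintro ⟨i, hi⟩
  rw [← h] at hi
  exact Fin.succ_ne_zero i (w.injective hi)

/-- Equal leading vertices force the even permutation between `w` and `w'` to fix `0`, and it then
restricts to an even permutation of the tails. -/
theorem mk_tail_eq {w w' : OrderedSimplex K (n + 1)} {u u' : OrderedSimplex K n}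
    (hw : (Quotient.mk _ w : OrientedSimplex K (n + 1)) = Quotient.mk _ w')
    (hu : Fin.tail w.vertex = u.vertex) (hu' : Fin.tail w'.vertex = u'.vertex)
    (h0 : w.vertex 0 = w'.vertex 0) :
    (Quotient.mk _ u : OrientedSimplex K n) = Quotient.mk _ u' := by
  obtain ⟨π, hπ, h⟩ := OrientedSimplex.mk_eq_mk.1 hw
  have hπ0 : π 0 = 0 := by
    have := congrFun h 0
    rw [← h0] at this
    exact (w.injective this).symm
  obtain ⟨e, he, hes⟩ := exists_restrict_perm hπ hπ0
  refine OrientedSimplex.mk_eq_mk.2 ⟨e, he, ?_⟩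
  funext i
  rw [← hu', ← hu]
  simp [Fin.tail, h, hes]

/-- A flag consists of an oriented simplex and the orientation it induces on a primary face. -/
theorem Flag.exists_rep (f : Flag K n) :
    ∃ (w : OrderedSimplex K (n + 1)) (u : OrderedSimplex K n),
      f.σ = Quotient.mk _ w ∧ f.τ = Quotient.mk _ u ∧ Fin.tail w.vertex = u.vertex := by
  obtain ⟨σ, τ, hf⟩ := f
  induction τ using Quotient.inductionOn with
  | h u =>
    obtain ⟨w, rfl, h⟩ := inducedFace_mk_iff.1 hf
    exact ⟨w, u, rfl, rfl, h⟩

theorem Flag.support_subset (f : Flag K n) : f.τ.support ⊆ f.σ.support := by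
  classical
  obtain ⟨w, u, hw, hu, h⟩ := f.exists_rep
  rw [hw, hu, OrientedSimplex.support_mk, OrientedSimplex.support_mk,
    OrderedSimplex.support_eq_insert h]
  exact Finset.subset_insert _ _

/-- With a fixed ordering `u` of the face, the larger simplex is `u` preceded by its one extra
vertex, which the support determines. -/
theorem Flag.eq_of_face_eq {f f' : Flag K n} (hτ : f.τ = f'.τ)
    (hσ : f.σ.support = f'.σ.support) : f = f' := by
  classical
  obtain ⟨w, u, hw, hu, h⟩ := f.exists_rep
  obtain ⟨w', hw', h'⟩ := inducedFace_mk_iff.1 (hu ▸ hτ ▸ f'.face)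
  have h0 : w.vertex 0 = w'.vertex 0 := by
    rw [hw, ← hw', OrientedSimplex.support_mk, OrientedSimplex.support_mk,
      OrderedSimplex.support_eq_insert h, OrderedSimplex.support_eq_insert h'] at hσ
    have := hσ ▸ Finset.mem_insert_self (w.vertex 0) u.support
    exact (Finset.mem_insert.1 this).resolve_right (OrderedSimplex.zero_notMem_support h)
  refine Flag.ext ?_ hτ
  rw [hw, ← hw']
  congr 1
  apply OrderedSimplex.ext_vertex
  rw [← Fin.cons_self_tail w.vertex, ← Fin.cons_self_tail w'.vertex, h, h', h0]

theorem Flag.eq_of_coface_eq {f f' : Flag K n} (hσ : f.σ = f'.σ)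
    (hτ : f.τ.support = f'.τ.support) : f = f' := by
  classical
  obtain ⟨w, u, hw, hu, h⟩ := f.exists_rep
  obtain ⟨w', u', hw', hu', h'⟩ := f'.exists_rep
  have hww : (Quotient.mk _ w : OrientedSimplex K (n + 1)) = Quotient.mk _ w' := by
    rw [← hw, ← hw', hσ]
  rw [hu, hu', OrientedSimplex.support_mk, OrientedSimplex.support_mk] at hτ
  have h0 : w.vertex 0 = w'.vertex 0 := by
    have hs := congrArg OrientedSimplex.support hww
    rw [OrientedSimplex.support_mk, OrientedSimplex.support_mk,
      OrderedSimplex.support_eq_insert h, OrderedSimplex.support_eq_insert h', ← hτ] at hs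
    have := hs ▸ Finset.mem_insert_self (w.vertex 0) u.support
    exact (Finset.mem_insert.1 this).resolve_right (OrderedSimplex.zero_notMem_support h)
  refine Flag.ext hσ ?_
  rw [hu, hu']
  exact mk_tail_eq hww h h' h0

end General

/-! ### Existence of flags and orientations in the sphere complex -/

section Sphere

variable {n : ℕ}

theorem mem_sphereComplex {s : Finset (Fin (n + 2))} :
    s ∈ (sphereComplex n).faces ↔ s.Nonempty ∧ s.card ≤ n + 1 := by
  have h : (SimpleGraph.completeGraph (Fin (n + 2))).IsClique (s : Set (Fin (n + 2))) :=
    fun _ _ _ _ hab => hab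
  exact ⟨fun hs => ⟨hs.1.1, hs.2⟩, fun hs => ⟨⟨hs.1, h⟩, hs.2⟩⟩

theorem card_simplex (hn : 2 ≤ n) :
    Nat.card (Simplex (sphereComplex n) n) = (n + 2).choose 2 := by
  have e : Simplex (sphereComplex n) n ≃ {s : Finset (Fin (n + 2)) // s.card = n} :=
    Equiv.subtypeEquivRight fun s => by
      rw [mem_sphereComplex]
      refine ⟨fun h => h.2, fun h => ⟨⟨Finset.card_pos.1 (by omega), by omega⟩, h⟩⟩
  rw [Nat.card_congr e, Nat.card_eq_fintype_card, Fintype.card_finset_len, Fintype.card_fin,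
    Nat.choose_symm_add]

/-- An injective sequence of at most `n + 1` vertices is an ordered simplex of `sphereComplex n`. -/
def orderedOfInjective {m : ℕ} (hm : 0 < m) (hmn : m ≤ n + 1) (f : Fin m → Fin (n + 2))
    (hf : Function.Injective f) : OrderedSimplex (sphereComplex n) m where
  vertex := f
  injective := hf
  mem_faces := mem_sphereComplex.2
    ⟨⟨f ⟨0, hm⟩, by simp⟩, by simpa using hmn⟩

theorem exists_flag_of_notMem (τ : OrientedSimplex (sphereComplex n) n) {b : Fin (n + 2)}
    (hb : b ∉ τ.support) :
    ∃ f : Flag (sphereComplex n) n, f.τ = τ ∧ f.σ.support = insert b τ.support := by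
  induction τ using Quotient.inductionOn with
  | h u =>
    have hinj : Function.Injective (Fin.cons b u.vertex : Fin (n + 1) → Fin (n + 2)) := by
      rw [Fin.cons_injective_iff]
      refine ⟨?_, u.injective⟩
      rintro ⟨i, hi⟩
      exact hb (OrderedSimplex.mem_support.2 ⟨i, hi⟩)
    let w := orderedOfInjective (n := n) (Nat.succ_pos n) le_rfl _ hinj
    have hw : Fin.tail w.vertex = u.vertex := Fin.tail_cons _ _
    refine ⟨⟨Quotient.mk _ w, Quotient.mk _ u, inducedFace_mk_iff.2 ⟨w, rfl, hw⟩⟩, rfl, ?_⟩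
    exact OrderedSimplex.support_eq_insert hw

theorem exists_flag_of_mem (hn : 2 ≤ n) (σ : OrientedSimplex (sphereComplex n) (n + 1))
    {v : Fin (n + 2)} (hv : v ∈ σ.support) :
    ∃ f : Flag (sphereComplex n) n, f.σ = σ ∧ f.τ.support = σ.support.erase v := by
  induction σ using Quotient.inductionOn with
  | h w =>
    obtain ⟨i, rfl⟩ := OrderedSimplex.mem_support.1 hv
    -- An even reordering brings the vertex to be removed to the front, so the tail carries the
    -- induced orientation.
    obtain ⟨π, hπ, hi⟩ := exists_even_perm_zero hn i
    let w' := w.reorder π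
    have hww : (Quotient.mk _ w' : OrientedSimplex (sphereComplex n) (n + 1)) = Quotient.mk _ w :=
      (OrientedSimplex.mk_eq_mk.2 ⟨π, hπ, rfl⟩).symm
    let u := orderedOfInjective (n := n) (by omega) (Nat.le_succ n) (Fin.tail w'.vertex)
      (w'.injective.comp (Fin.succ_injective _))
    refine ⟨⟨Quotient.mk _ w, Quotient.mk _ u, inducedFace_mk_iff.2 ⟨w', hww, rfl⟩⟩, rfl, ?_⟩
    have h1 := OrderedSimplex.support_eq_insert (w := w') (u := u) rfl
    have h2 := OrderedSimplex.zero_notMem_support (w := w') (u := u) rfl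
    have h0 : w'.vertex 0 = w.vertex i := by simp [w', OrderedSimplex.reorder, hi]
    rw [OrderedSimplex.support_reorder] at h1
    rw [h0] at h1 h2
    change u.support = w.support.erase (w.vertex i)
    rw [h1, Finset.erase_insert h2]

/-- Every simplex with `n` vertices has exactly two orientations. -/
theorem card_orientations (hn : 2 ≤ n) (s : Simplex (sphereComplex n) n) :
    Nat.card {τ : OrientedSimplex (sphereComplex n) n // τ.support = s.1} = 2 := by
  have e : Fin n ≃ s.1 := (Finset.equivFinOfCardEq s.2.2).symm
  let u : OrderedSimplex (sphereComplex n) n :=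
    orderedOfInjective (by omega) (Nat.le_succ n) (fun i => (e i : Fin (n + 2)))
      (Subtype.val_injective.comp e.injective)
  have hu : u.support = s.1 := by
    ext v
    rw [OrderedSimplex.mem_support]
    exact ⟨fun ⟨i, hi⟩ => hi ▸ (e i).2, fun hv => ⟨e.symm ⟨v, hv⟩, by simp [u, orderedOfInjective]⟩⟩
  let a : Fin n := ⟨0, by omega⟩
  let b : Fin n := ⟨1, by omega⟩
  have hab : a ≠ b := by simp [a, b]
  let u' := u.reorder (Equiv.swap a b)
  have hne : (Quotient.mk _ u : OrientedSimplex (sphereComplex n) n) ≠ Quotient.mk _ u' := by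
    intro h
    obtain ⟨π, hπ, h⟩ := OrientedSimplex.mk_eq_mk.1 h
    have : Equiv.swap a b = π := Equiv.ext fun i => u.injective (congrFun h i)
    rw [← this, Equiv.Perm.mem_alternatingGroup, Equiv.Perm.sign_swap hab] at hπ
    exact absurd hπ (by decide)
  rw [Nat.card_eq_two_iff]
  refine ⟨⟨Quotient.mk _ u, hu⟩, ⟨Quotient.mk _ u', (u.support_reorder _).trans hu⟩,
    fun h => hne (congrArg Subtype.val h), ?_⟩
  rw [Set.eq_univ_iff_forall]
  rintro ⟨τ, hτ⟩
  induction τ using Quotient.inductionOn with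
  | h w =>
    have hmem : ∀ i, ∃ j, u.vertex j = w.vertex i := fun i => by
      rw [← OrderedSimplex.mem_support, hu, ← hτ]
      exact OrderedSimplex.mem_support.2 ⟨i, rfl⟩
    choose g hg using hmem
    have hginj : Function.Injective g := fun i j hij => w.injective (by rw [← hg, ← hg, hij])
    let π : Equiv.Perm (Fin n) := Equiv.ofBijective g (Finite.injective_iff_bijective.1 hginj)
    have hπ : w.vertex = u.vertex ∘ π := funext fun i => (hg i).symm
    rcases Int.units_eq_one_or (Equiv.Perm.sign π) with h1 | h1
    · left
      refine Subtype.ext (OrientedSimplex.mk_eq_mk.2 ⟨π, h1, hπ⟩).symm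
    · right
      refine Subtype.ext (OrientedSimplex.mk_eq_mk.2 ⟨Equiv.swap a b * π, ?_, ?_⟩).symm
      · rw [Equiv.Perm.mem_alternatingGroup, map_mul, h1, Equiv.Perm.sign_swap hab]
        rfl
      · rw [hπ]
        funext i
        simp [u', OrderedSimplex.reorder]

end Sphere

end SimplicialWalk

namespace SimplicialWalk

/-! ### Flags as arcs of the complete graph -/

section Arcs

variable {n : ℕ}

/-- A flag of the sphere complex is determined, up to orientation, by an arc `(a, v)` of the complete
graph: `a` is missing from the larger simplex, and `v` is the further vertex missing from the face. -/
theorem Flag.exists_arc (f : Flag (sphereComplex n) n) :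
    ∃ p : Fin (n + 2) × Fin (n + 2), p.1 ≠ p.2 ∧ f.σ.support = {p.1}ᶜ ∧
      f.τ.support = {p.1, p.2}ᶜ := by
  have h1 : f.σ.supportᶜ.card = 1 := by
    rw [Finset.card_compl, f.σ.card_support, Fintype.card_fin]; omega
  have h2 : (f.σ.support \ f.τ.support).card = 1 := by
    rw [Finset.card_sdiff_of_subset f.support_subset, f.σ.card_support, f.τ.card_support]; omega
  obtain ⟨a, ha⟩ := Finset.card_eq_one.1 h1
  obtain ⟨v, hv⟩ := Finset.card_eq_one.1 h2
  have ha' : ∀ i, i ∉ f.σ.support ↔ i = a := fun i => by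
    rw [← Finset.mem_compl, ha, Finset.mem_singleton]
  have hv' : ∀ i, (i ∈ f.σ.support ∧ i ∉ f.τ.support) ↔ i = v := fun i => by
    rw [← Finset.mem_sdiff, hv, Finset.mem_singleton]
  have hs := f.support_subset
  refine ⟨(a, v), ?_, ?_, ?_⟩
  · intro h
    exact (ha' v).2 h.symm ((hv' v).2 rfl).1
  · rw [← ha, compl_compl]
  · ext i
    have h3 := ha' i
    have h4 := hv' i
    have h5 := @hs i
    simp only [Finset.mem_compl, Finset.mem_insert, Finset.mem_singleton]
    tauto

/-- The vertex missing from the larger simplex of a flag. -/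
noncomputable def Flag.omitted (f : Flag (sphereComplex n) n) : Fin (n + 2) :=
  f.exists_arc.choose.1

/-- The vertex of the larger simplex of a flag missing from its face. -/
noncomputable def Flag.dropped (f : Flag (sphereComplex n) n) : Fin (n + 2) :=
  f.exists_arc.choose.2

theorem Flag.omitted_ne_dropped (f : Flag (sphereComplex n) n) : f.omitted ≠ f.dropped :=
  f.exists_arc.choose_spec.1

theorem Flag.support_σ (f : Flag (sphereComplex n) n) : f.σ.support = {f.omitted}ᶜ :=
  f.exists_arc.choose_spec.2.1

theorem Flag.support_τ (f : Flag (sphereComplex n) n) : f.τ.support = {f.omitted, f.dropped}ᶜ :=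
  f.exists_arc.choose_spec.2.2

theorem Flag.omitted_eq {f : Flag (sphereComplex n) n} {a : Fin (n + 2)}
    (h : f.σ.support = {a}ᶜ) : f.omitted = a := by
  rw [f.support_σ, compl_inj_iff, Finset.singleton_inj] at h
  exact h

theorem Flag.dropped_eq {f : Flag (sphereComplex n) n} {a v : Fin (n + 2)}
    (h : f.σ.support = {a}ᶜ) (h' : f.τ.support = {a, v}ᶜ) : f.dropped = v := by
  have ha := Flag.omitted_eq h
  have hne := f.omitted_ne_dropped
  rw [f.support_τ, compl_inj_iff, ha] at h'
  have : f.dropped ∈ ({a, v} : Finset (Fin (n + 2))) := by rw [← h']; simp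
  simp only [Finset.mem_insert, Finset.mem_singleton] at this
  exact this.resolve_left fun h => hne (ha.trans h.symm)

theorem Flag.support_τ_eq_iff (f : Flag (sphereComplex n) n) (s : Simplex (sphereComplex n) n) :
    f.τ.support = s.1 ↔ f.omitted ∉ s.1 ∧ f.dropped ∉ s.1 := by
  constructor
  · intro h
    rw [← h, f.support_τ]
    simp
  · rintro ⟨h1, h2⟩
    symm
    refine Finset.eq_of_subset_of_card_le (fun i hi => ?_) (by rw [f.τ.card_support, s.2.2])
    rw [f.support_τ]
    simp only [Finset.mem_compl, Finset.mem_insert, Finset.mem_singleton, not_or]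
    exact ⟨fun h => h1 (h ▸ hi), fun h => h2 (h ▸ hi)⟩

/-- The other flag with the same oriented face. -/
theorem Flag.exists_partner (f : Flag (sphereComplex n) n) :
    ∃ f' : Flag (sphereComplex n) n, f'.τ = f.τ ∧ f'.omitted = f.dropped ∧
      f'.dropped = f.omitted := by
  have hne := f.omitted_ne_dropped
  obtain ⟨f', hτ, hσ⟩ := exists_flag_of_notMem f.τ (b := f.omitted) (by simp [f.support_τ])
  have hσ' : f'.σ.support = {f.dropped}ᶜ := by
    rw [hσ, f.support_τ]
    ext i
    simp only [Finset.mem_insert, Finset.mem_compl, Finset.mem_singleton, not_or]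
    by_cases h : i = f.omitted
    · simp [h, hne]
    · simp [h]
  refine ⟨f', hτ, Flag.omitted_eq hσ', Flag.dropped_eq hσ' ?_⟩
  rw [hτ, f.support_τ, Finset.pair_comm]

/-- A face omits exactly two vertices, so its oriented version lies in two flags, one for each
choice of the vertex still omitted by the larger simplex. -/
theorem Flag.eq_partner_iff {f f' : Flag (sphereComplex n) n} (hτ : f'.τ = f.τ)
    (ho : f'.omitted = f.dropped) {y : Flag (sphereComplex n) n} :
    (y.τ = f.τ ∧ f ≠ y) ↔ f' = y := by
  constructor
  · rintro ⟨hy, hne⟩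
    refine Flag.eq_of_face_eq (hτ.trans hy.symm) ?_
    rw [f'.support_σ, y.support_σ, ho]
    have h1 : y.omitted ≠ f.omitted := fun h =>
      hne (Flag.eq_of_face_eq hy.symm (by rw [f.support_σ, y.support_σ, h]))
    have h2 : y.omitted ∉ f.τ.support := by rw [← hy, y.support_τ]; simp
    rw [f.support_τ] at h2
    simp only [Finset.mem_compl, Finset.mem_insert, Finset.mem_singleton, not_not] at h2
    rw [h2.resolve_left h1]
  · rintro rfl
    refine ⟨hτ, ?_⟩
    rintro rfl
    exact f.omitted_ne_dropped ho

/-- The sum over the flags with a given larger simplex is a sum over the dropped vertex. -/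
theorem sum_coface (hn : 2 ≤ n) (f : Flag (sphereComplex n) n)
    (h : Fin (n + 2) → Fin (n + 2) → ℂ) [DecidablePred fun y : Flag (sphereComplex n) n => y.σ = f.σ] :
    ∑ y : Flag (sphereComplex n) n with y.σ = f.σ, h y.omitted y.dropped =
      ∑ w ∈ Finset.univ.erase f.omitted, h f.omitted w := by
  have ho : ∀ y : Flag (sphereComplex n) n, y.σ = f.σ → y.omitted = f.omitted := fun y hy =>
    Flag.omitted_eq (by rw [hy, f.support_σ])
  refine Finset.sum_bij (fun y _ => y.dropped) ?_ ?_ ?_ ?_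
  · intro y hy
    have hy := ho y (Finset.mem_filter.1 hy).2
    simp only [Finset.mem_erase, Finset.mem_univ, and_true]
    exact fun h => y.omitted_ne_dropped (hy.trans h.symm)
  · intro y hy y' hy' hd
    have hy := (Finset.mem_filter.1 hy).2
    have hy' := (Finset.mem_filter.1 hy').2
    refine Flag.eq_of_coface_eq (hy.trans hy'.symm) ?_
    rw [y.support_τ, y'.support_τ, hd, ho y hy, ho y' hy']
  · intro w hw
    have hw : w ≠ f.omitted := (Finset.mem_erase.1 hw).1
    obtain ⟨y, hy, hyτ⟩ := exists_flag_of_mem hn f.σ (v := w) (by simp [f.support_σ, hw])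
    refine ⟨y, by simp [hy], Flag.dropped_eq (a := f.omitted) (by rw [hy, f.support_σ]) ?_⟩
    rw [hyτ, f.support_σ]
    ext i
    simp [and_comm]
  · intro y hy
    rw [ho y (Finset.mem_filter.1 hy).2]

theorem card_compl_simplex (s : Simplex (sphereComplex n) n) : s.1ᶜ.card = 2 := by
  rw [Finset.card_compl, s.2.2, Fintype.card_fin]; omega

/-- Two orientations of `s` times two choices of the dropped vertex. -/
theorem card_flags_over (hn : 2 ≤ n) (s : Simplex (sphereComplex n) n) :
    Nat.card {f : Flag (sphereComplex n) n // f.τ.support = s.1} = 4 := by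
  let φ : {f : Flag (sphereComplex n) n // f.τ.support = s.1} →
      {τ : OrientedSimplex (sphereComplex n) n // τ.support = s.1} × {b // b ∈ s.1ᶜ} :=
    fun f => (⟨f.1.τ, f.2⟩, ⟨f.1.dropped,
      Finset.mem_compl.2 ((f.1.support_τ_eq_iff s).1 f.2).2⟩)
  have hins : ∀ f : Flag (sphereComplex n) n,
      f.σ.support = insert f.dropped f.τ.support := fun f => by
    have := f.omitted_ne_dropped
    rw [f.support_σ, f.support_τ]
    ext i
    simp only [Finset.mem_insert, Finset.mem_compl, Finset.mem_singleton, not_or]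
    by_cases h : i = f.dropped
    · simp [h, this.symm]
    · simp [h]
  have hφ : Function.Bijective φ := by
    constructor
    · rintro ⟨f, hf⟩ ⟨f', hf'⟩ h
      have h1 : f.τ = f'.τ := congrArg (fun p => p.1.1) h
      have h2 : f.dropped = f'.dropped := congrArg (fun p => p.2.1) h
      exact Subtype.ext (Flag.eq_of_face_eq h1 (by rw [hins, hins, h1, h2]))
    · rintro ⟨⟨τ, hτ⟩, ⟨b, hb⟩⟩
      rw [Finset.mem_compl, ← hτ] at hb
      obtain ⟨f, rfl, hf⟩ := exists_flag_of_notMem τ hb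
      refine ⟨⟨f, hτ⟩, Prod.ext rfl (Subtype.ext ?_)⟩
      have h1 : b ∈ insert f.dropped f.τ.support := by
        rw [← hins, hf]; exact Finset.mem_insert_self _ _
      exact ((Finset.mem_insert.1 h1).resolve_right hb).symm
  rw [Nat.card_congr (Equiv.ofBijective φ hφ), Nat.card_prod, card_orientations hn,
    Nat.card_eq_fintype_card, Fintype.card_coe, card_compl_simplex]

end Arcs

/-! ### Reduction to four amplitudes -/

section Reduction

variable {n : ℕ}

/-- The state whose amplitude at a flag is a function of its omitted and dropped vertices. -/
noncomputable def arcState (g : Fin (n + 2) → Fin (n + 2) → ℂ) :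
    EuclideanSpace ℂ (Flag (sphereComplex n) n) :=
  WithLp.toLp 2 fun f => g f.omitted f.dropped

/-- The unmarked flip exchanges a flag with its partner, which is the reversed arc; on marked arcs
only the sign changes. -/
theorem toEuclideanLin_searchE_arcState (s : Simplex (sphereComplex n) n)
    (g : Fin (n + 2) → Fin (n + 2) → ℂ) :
    Matrix.toEuclideanLin (firstMatrix (searchE s)) (arcState g) =
      arcState fun a v => if a ∉ s.1 ∧ v ∉ s.1 then -g a v else g v a := by
  classical
  ext f
  change ∑ y, firstMatrix (searchE s) f y * g y.omitted y.dropped = _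
  obtain ⟨f', hτ, ho, hd⟩ := f.exists_partner
  change _ = if f.omitted ∉ s.1 ∧ f.dropped ∉ s.1 then _ else _
  by_cases h : f.τ.support = s.1
  · rw [if_pos ((f.support_τ_eq_iff s).1 h), Finset.sum_eq_single f]
    · simp [firstMatrix, searchE, h]
    · intro y _ hy
      simp only [firstMatrix, searchE, if_pos h]
      split_ifs with h1
      · simp [hy.symm]
      · simp
    · simp
  · rw [if_neg (mt (f.support_τ_eq_iff s).2 h), Finset.sum_eq_single f']
    · obtain ⟨-, hne⟩ := (Flag.eq_partner_iff hτ ho).2 rfl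
      simp [firstMatrix, searchE, h, hτ, hne, ho, hd]
    · intro y _ hy
      simp only [firstMatrix, searchE, if_neg h]
      split_ifs with h1
      · have : f = y := by
          by_contra hne
          exact hy ((Flag.eq_partner_iff hτ ho).1 ⟨h1, hne⟩).symm
        simp [this]
      · simp
    · simp

theorem toEuclideanLin_groverF_arcState (hn : 2 ≤ n) (g : Fin (n + 2) → Fin (n + 2) → ℂ) :
    Matrix.toEuclideanLin (secondMatrix groverF) (arcState g) =
      arcState fun a v => 2 / ((n : ℂ) + 1) * ∑ w ∈ Finset.univ.erase a, g a w - g a v := by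
  classical
  ext f
  change ∑ y, secondMatrix groverF f y * g y.omitted y.dropped =
    2 / ((n : ℂ) + 1) * ∑ w ∈ Finset.univ.erase f.omitted, g f.omitted w - g f.omitted f.dropped
  have h : ∀ y : Flag (sphereComplex n) n, secondMatrix groverF f y * g y.omitted y.dropped =
      2 / ((n : ℂ) + 1) * (if y.σ = f.σ then g y.omitted y.dropped else 0) -
        if f = y then g y.omitted y.dropped else 0 := by
    intro y
    simp only [secondMatrix, groverF]
    by_cases h1 : y.σ = f.σ
    · by_cases h2 : f = y
      · subst h2
        simp [sub_mul]
      · simp [h1, h2]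
    · have h2 : f ≠ y := by rintro rfl; exact h1 rfl
      simp [h1, h2]
  rw [Finset.sum_congr rfl fun y _ => h y, Finset.sum_sub_distrib, ← Finset.mul_sum,
    ← Finset.sum_filter, sum_coface hn, Finset.sum_ite_eq]
  simp

/-- Amplitudes constant on the four orbits of arcs `(a, v)`: both endpoints outside `s`, only `a`
outside `s`, only `v` outside `s`, and both endpoints in `s`. -/
def classAmp (s : Finset (Fin (n + 2))) (x y z u : ℝ) (a v : Fin (n + 2)) : ℂ :=
  if a ∈ s then (if v ∈ s then (u : ℂ) else z) else (if v ∈ s then (y : ℂ) else x)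

theorem sum_ite_mem_simplex (s : Simplex (sphereComplex n) n) (p q : ℂ) :
    ∑ w, (if w ∈ s.1 then p else q) = n * p + 2 * q := by
  rw [Finset.sum_ite, Finset.sum_const, Finset.sum_const, Finset.filter_mem_eq_inter,
    Finset.univ_inter, Finset.filter_notMem_eq_sdiff, ← Finset.compl_eq_univ_sdiff,
    card_compl_simplex, s.2.2]
  simp

/-- An omitted vertex outside `s` has `n` arcs into `s` and one marked arc; an omitted vertex in `s`
has `n - 1` arcs inside `s` and two leaving it. These counts give the coefficients. -/
theorem searchEvolution_classAmp (hn : 2 ≤ n) (s : Simplex (sphereComplex n) n) (x y z u : ℝ) :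
    searchEvolution s (arcState (classAmp s.1 x y z u)) =
      arcState (classAmp s.1 (((n - 1) * x + 2 * n * z) / (n + 1))
        ((-2 * x + (n - 1) * z) / (n + 1)) (((3 - n) * y + 2 * (n - 1) * u) / (n + 1))
        ((4 * y + (n - 3) * u) / (n + 1))) := by
  have hn0 : (n : ℂ) + 1 ≠ 0 := by exact_mod_cast Nat.succ_ne_zero n
  rw [searchEvolution, evolution, LinearMap.comp_apply, toEuclideanLin_searchE_arcState,
    toEuclideanLin_groverF_arcState hn]
  congr 1
  funext a v
  -- The pair `(a, a)` is not an arc; summing over all `w` and subtracting its formal value lets one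
  -- class count serve every `a`.
  have hsum : ∀ h : Fin (n + 2) → ℂ, ∑ w ∈ Finset.univ.erase a, h w = ∑ w, h w - h a := fun h => by
    rw [← Finset.add_sum_erase _ h (Finset.mem_univ a)]; ring
  rw [hsum]
  by_cases ha : a ∈ s.1
  · have h1 : ∀ w, (if a ∉ s.1 ∧ w ∉ s.1 then -classAmp s.1 x y z u a w
        else classAmp s.1 x y z u w a) = if w ∈ s.1 then (u : ℂ) else y := fun w => by
      simp [classAmp, ha]
    simp only [h1]
    rw [sum_ite_mem_simplex, if_pos ha]
    by_cases hv : v ∈ s.1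
    · simp only [classAmp, ha, hv, if_true]
      push_cast
      field_simp
      ring
    · simp only [classAmp, ha, hv, if_true, if_false]
      push_cast
      field_simp
      ring
  · have h1 : ∀ w, (if a ∉ s.1 ∧ w ∉ s.1 then -classAmp s.1 x y z u a w
        else classAmp s.1 x y z u w a) = if w ∈ s.1 then (z : ℂ) else -x := fun w => by
      by_cases hw : w ∈ s.1 <;> simp [classAmp, ha, hw]
    simp only [h1]
    rw [sum_ite_mem_simplex, if_neg ha]
    by_cases hv : v ∈ s.1
    · simp only [classAmp, ha, hv, if_true, if_false]
      push_cast
      field_simp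
      ring
    · simp only [classAmp, ha, hv, if_false]
      push_cast
      field_simp
      ring

theorem observeProb_classAmp (hn : 2 ≤ n) (s : Simplex (sphereComplex n) n) (x y z u : ℝ) :
    observeProb (arcState (classAmp s.1 x y z u)) s = 4 * x ^ 2 := by
  classical
  have h : ∀ f ∈ Finset.univ.filter fun f : Flag (sphereComplex n) n => f.τ.support = s.1,
      ‖arcState (classAmp s.1 x y z u) f‖ ^ 2 = x ^ 2 := by
    intro f hf
    obtain ⟨h1, h2⟩ := (f.support_τ_eq_iff s).1 (Finset.mem_filter.1 hf).2
    simp [arcState, classAmp, h1, h2]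
  have hcard := card_flags_over hn s
  rw [Nat.card_eq_fintype_card, Fintype.card_subtype] at hcard
  have hsum := Finset.sum_congr rfl h
  rw [Finset.sum_const, hcard, nsmul_eq_mul] at hsum
  refine Eq.trans (Finset.sum_congr ?_ fun _ _ => rfl) (hsum.trans (by norm_num))
  ext f
  simp

theorem uniformState_eq_classAmp (hn : 2 ≤ n) (s : Simplex (sphereComplex n) n) :
    uniformState (sphereComplex n) n =
      arcState (classAmp s.1 (1 / (2 * √((n + 2).choose 2 : ℝ))) (1 / (2 * √((n + 2).choose 2 : ℝ)))
        (1 / (2 * √((n + 2).choose 2 : ℝ))) (1 / (2 * √((n + 2).choose 2 : ℝ)))) := by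
  ext f
  simp [uniformState, arcState, classAmp, card_simplex hn]

end Reduction

end SimplicialWalk

namespace SimplicialWalk

/-! ### A slow curve for the four-dimensional isometry -/

section ReducedWalk

/-- One step of the reduced four-dimensional walk. -/
noncomputable def reducedStep (a b α β : ℝ) (v : EuclideanSpace ℝ (Fin 4)) :
    EuclideanSpace ℝ (Fin 4) :=
  !₂[v 0 - a * v 0 + α * v 2, v 2 - a * v 2 - α * v 0, -v 1 + b * v 1 + β * v 3,
    v 3 - b * v 3 + β * v 1]

/-- A curve on which the reduced walk approximately acts as a translation by `α * β / 2`. -/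
noncomputable def slowCurve (α β θ : ℝ) : EuclideanSpace ℝ (Fin 4) :=
  !₂[Real.sin θ, (β * Real.cos θ - α * Real.sin θ) / 2, (β * Real.cos θ + α * Real.sin θ) / 2,
    Real.cos θ]

theorem dist_le_sum_abs (v w : EuclideanSpace ℝ (Fin 4)) :
    dist v w ≤ |v 0 - w 0| + |v 1 - w 1| + |v 2 - w 2| + |v 3 - w 3| := by
  rw [EuclideanSpace.dist_eq]
  apply Real.sqrt_le_iff.2
  simp only [Fin.sum_univ_four, Real.dist_eq]
  refine ⟨by positivity, ?_⟩
  nlinarith [abs_nonneg (v 0 - w 0), abs_nonneg (v 1 - w 1), abs_nonneg (v 2 - w 2),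
    abs_nonneg (v 3 - w 3), mul_nonneg (abs_nonneg (v 0 - w 0)) (abs_nonneg (v 1 - w 1)),
    mul_nonneg (abs_nonneg (v 0 - w 0)) (abs_nonneg (v 2 - w 2)),
    mul_nonneg (abs_nonneg (v 0 - w 0)) (abs_nonneg (v 3 - w 3)),
    mul_nonneg (abs_nonneg (v 1 - w 1)) (abs_nonneg (v 2 - w 2)),
    mul_nonneg (abs_nonneg (v 1 - w 1)) (abs_nonneg (v 3 - w 3)),
    mul_nonneg (abs_nonneg (v 2 - w 2)) (abs_nonneg (v 3 - w 3))]

/-- The hypotheses say `(1 - a) ^ 2 + α ^ 2 = 1` and `(1 - b) ^ 2 + β ^ 2 = 1`: the step is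
orthogonal in the planes of `v 0`, `v 2` and of `v 1`, `v 3`, followed by a relabelling. -/
theorem reducedStep_dist {a b α β : ℝ} (hα : α ^ 2 = 2 * a - a ^ 2) (hβ : β ^ 2 = 2 * b - b ^ 2)
    (v w : EuclideanSpace ℝ (Fin 4)) :
    dist (reducedStep a b α β v) (reducedStep a b α β w) = dist v w := by
  rw [EuclideanSpace.dist_eq, EuclideanSpace.dist_eq]
  congr 1
  simp only [Fin.sum_univ_four, Real.dist_eq, sq_abs, reducedStep, PiLp.toLp_apply]
  simp
  linear_combination ((v 0 - w 0) ^ 2 + (v 2 - w 2) ^ 2) * hα +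
    ((v 1 - w 1) ^ 2 + (v 3 - w 3) ^ 2) * hβ

/-- Shadowing: an isometry carries past errors along unchanged, so each step adds at most `η`. -/
theorem dist_iterate_le {X : Type*} [PseudoMetricSpace X] {f : X → X}
    (hf : ∀ x y, dist (f x) (f y) = dist x y) {w : ℕ → X} {η : ℝ}
    (hw : ∀ k, dist (f (w k)) (w (k + 1)) ≤ η) (x : X) (t : ℕ) :
    dist (f^[t] x) (w t) ≤ dist x (w 0) + t * η := by
  induction t with
  | zero => simp
  | succ t ih =>
    rw [Function.iterate_succ_apply']
    calc dist (f (f^[t] x)) (w (t + 1))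
        ≤ dist (f (f^[t] x)) (f (w t)) + dist (f (w t)) (w (t + 1)) := dist_triangle _ _ _
      _ ≤ (dist x (w 0) + t * η) + η := by rw [hf]; exact add_le_add ih (hw t)
      _ = _ := by push_cast; ring

/-- The bound `5` keeps the cubic remainder below `δ ^ 2`; the rotation angle to which this is
applied is at most `9 / 2`. -/
theorem abs_sin_sub_self_le {δ : ℝ} (hδ : 0 < δ) (hδ5 : δ ≤ 5) : |Real.sin δ - δ| ≤ δ ^ 2 := by
  have h1 := Real.sin_lt hδ
  have h2 := Real.sin_gt_sub_cube hδ
  rw [abs_le]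
  constructor <;> nlinarith [mul_pos hδ hδ]

theorem abs_sin_taylor_le {δ : ℝ} (hδ : 0 < δ) (hδ5 : δ ≤ 5) (θ : ℝ) :
    |Real.sin (θ + δ) - Real.sin θ - δ * Real.cos θ| ≤ 2 * δ ^ 2 := by
  have h1 := abs_sin_sub_self_le hδ hδ5
  have h2 : |Real.cos δ - 1| ≤ δ ^ 2 := by
    have := Real.one_sub_sq_div_two_le_cos (x := δ)
    have := Real.cos_le_one δ
    rw [abs_le]
    constructor <;> nlinarith
  have h3 : Real.sin (θ + δ) - Real.sin θ - δ * Real.cos θ =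
      Real.sin θ * (Real.cos δ - 1) + Real.cos θ * (Real.sin δ - δ) := by
    rw [Real.sin_add]; ring
  rw [h3]
  calc _ ≤ |Real.sin θ| * |Real.cos δ - 1| + |Real.cos θ| * |Real.sin δ - δ| := by
        rw [← abs_mul, ← abs_mul]; exact abs_add_le _ _
    _ ≤ 1 * δ ^ 2 + 1 * δ ^ 2 := by
        gcongr
        · exact Real.abs_sin_le_one θ
        · exact Real.abs_cos_le_one θ
    _ = _ := by ring

theorem abs_cos_taylor_le {δ : ℝ} (hδ : 0 < δ) (hδ5 : δ ≤ 5) (θ : ℝ) :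
    |Real.cos (θ + δ) - Real.cos θ + δ * Real.sin θ| ≤ 2 * δ ^ 2 := by
  -- The cosine is the sine shifted by a quarter turn.
  have h := abs_sin_taylor_le hδ hδ5 (θ + Real.pi / 2)
  rw [Real.cos_add_pi_div_two, Real.sin_add_pi_div_two, add_right_comm,
    Real.sin_add_pi_div_two] at h
  convert h using 2
  ring

theorem abs_comb_le {α β p q : ℝ} (hα : 0 ≤ α) (hβ : 0 ≤ β) {M : ℝ} (hp : |p| ≤ M)
    (hq : |q| ≤ M) : |(β * p + α * q) / 2| ≤ (α + β) / 2 * M := by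
  rw [abs_le] at *
  constructor <;> nlinarith

/-- The slaved middle coordinates cancel all terms of order `h` and leave a rotation by `α * β / 2`
at order `h ^ 2`. The constant is `50 + 26 + 26 + 50`, one summand per coordinate. -/
theorem dist_reducedStep_slowCurve_le {a b α β h : ℝ} (ha : 0 ≤ a) (hb : 0 ≤ b) (hα0 : 0 < α)
    (hβ0 : 0 < β) (hα : α ^ 2 = 2 * a - a ^ 2) (hβ : β ^ 2 = 2 * b - b ^ 2) (h1 : h ≤ 1)
    (ha' : a ≤ 4 * h ^ 2) (hb' : b ≤ 4 * h ^ 2) (hα' : α ≤ 3 * h) (hβ' : β ≤ 3 * h) (θ : ℝ) :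
    dist (reducedStep a b α β (slowCurve α β θ)) (slowCurve α β (θ + α * β / 2)) ≤
      152 * h ^ 3 := by
  have hh : 0 ≤ h := by linarith
  set δ := α * β / 2 with hδdef
  have hδ : 0 < δ := by positivity
  have hδ' : δ ≤ 9 / 2 * h ^ 2 := by
    have : α * β ≤ (3 * h) * (3 * h) := by gcongr
    nlinarith
  have hh2 : h ^ 2 ≤ 1 := pow_le_one₀ hh h1
  have hh43 : h ^ 4 ≤ h ^ 3 := pow_le_pow_of_le_one hh h1 (by norm_num)
  have hδ5 : δ ≤ 5 := by linarith
  have hδ2 : δ ^ 2 ≤ 81 / 4 * h ^ 3 := by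
    calc δ ^ 2 ≤ (9 / 2 * h ^ 2) ^ 2 := by gcongr
      _ = 81 / 4 * h ^ 4 := by ring
      _ ≤ _ := by gcongr
  have ha2 : a ^ 2 ≤ 16 * h ^ 3 := by
    calc a ^ 2 ≤ (4 * h ^ 2) ^ 2 := by gcongr
      _ = 16 * h ^ 4 := by ring
      _ ≤ _ := by gcongr
  have hb2 : b ^ 2 ≤ 16 * h ^ 3 := by
    calc b ^ 2 ≤ (4 * h ^ 2) ^ 2 := by gcongr
      _ = 16 * h ^ 4 := by ring
      _ ≤ _ := by gcongr
  have hs1 := Real.abs_sin_le_one θ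
  have hc1 := Real.abs_cos_le_one θ
  have hs := abs_sin_taylor_le hδ hδ5 θ
  have hc := abs_cos_taylor_le hδ hδ5 θ
  have hds : |Real.sin θ - Real.sin (θ + δ)| ≤ δ := by
    have := Real.abs_sin_sub_sin_le θ (θ + δ)
    rwa [sub_add_cancel_left, abs_neg, abs_of_pos hδ] at this
  have hdc : |Real.cos θ - Real.cos (θ + δ)| ≤ δ := by
    have := Real.abs_cos_sub_cos_le θ (θ + δ)
    rwa [sub_add_cancel_left, abs_neg, abs_of_pos hδ] at this
  have hmid : ∀ c : ℝ, 0 ≤ c → c ≤ 4 * h ^ 2 →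
      (α + β) / 2 * δ + c * ((α + β) / 2) ≤ 26 * h ^ 3 := by
    intro c hc0 hc
    have h3 : (α + β) / 2 ≤ 3 * h := by linarith
    calc (α + β) / 2 * δ + c * ((α + β) / 2)
        ≤ 3 * h * (9 / 2 * h ^ 2) + 4 * h ^ 2 * (3 * h) := by gcongr
      _ = 51 / 2 * h ^ 3 := by ring
      _ ≤ _ := by nlinarith [pow_nonneg hh 3]
  refine (dist_le_sum_abs _ _).trans ?_
  simp only [reducedStep, slowCurve]
  simp
  set S := Real.sin θ
  set C := Real.cos θ
  set S' := Real.sin (θ + δ)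
  set C' := Real.cos (θ + δ)
  have e0 : |S - a * S + α * ((β * C + α * S) / 2) - S'| ≤ 50 * h ^ 3 := by
    -- By `hα`, the loss `a * S` is repaid by `α ^ 2 / 2 * S` up to `a ^ 2 / 2 * S`; what remains is
    -- the Taylor error of the rotation.
    have : S - a * S + α * ((β * C + α * S) / 2) - S' =
        -(S' - S - δ * C) - a ^ 2 / 2 * S := by
      rw [hδdef]; linear_combination S / 2 * hα
    rw [this]
    have h4 : |a ^ 2 / 2 * S| ≤ a ^ 2 / 2 := by
      rw [abs_mul, abs_of_nonneg (by positivity : (0 : ℝ) ≤ a ^ 2 / 2)]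
      exact mul_le_of_le_one_right (by positivity) hs1
    calc _ ≤ |-(S' - S - δ * C)| + |a ^ 2 / 2 * S| := abs_sub _ _
      _ ≤ 2 * δ ^ 2 + a ^ 2 / 2 := by rw [abs_neg]; exact add_le_add hs h4
      _ ≤ _ := by linarith [pow_nonneg hh 3]
  have e3 : |C - b * C + β * ((β * C - α * S) / 2) - C'| ≤ 50 * h ^ 3 := by
    have : C - b * C + β * ((β * C - α * S) / 2) - C' =
        -(C' - C + δ * S) - b ^ 2 / 2 * C := by
      rw [hδdef]; linear_combination C / 2 * hβ
    rw [this]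
    have h4 : |b ^ 2 / 2 * C| ≤ b ^ 2 / 2 := by
      rw [abs_mul, abs_of_nonneg (by positivity : (0 : ℝ) ≤ b ^ 2 / 2)]
      exact mul_le_of_le_one_right (by positivity) hc1
    calc _ ≤ |-(C' - C + δ * S)| + |b ^ 2 / 2 * C| := abs_sub _ _
      _ ≤ 2 * δ ^ 2 + b ^ 2 / 2 := by rw [abs_neg]; exact add_le_add hc h4
      _ ≤ _ := by linarith [pow_nonneg hh 3]
  -- The middle coordinates solve the stationary relation, so only the advance of the angle by `δ`
  -- and the factor `1 - a` contribute.
  have e1 : |(β * C + α * S) / 2 - a * ((β * C + α * S) / 2) - α * S -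
      (β * C' - α * S') / 2| ≤ 26 * h ^ 3 := by
    have : (β * C + α * S) / 2 - a * ((β * C + α * S) / 2) - α * S - (β * C' - α * S') / 2 =
        (β * (C - C') + α * (-(S - S'))) / 2 - a * ((β * C + α * S) / 2) := by ring
    rw [this]
    calc _ ≤ |(β * (C - C') + α * (-(S - S'))) / 2| + |a * ((β * C + α * S) / 2)| := abs_sub _ _
      _ ≤ (α + β) / 2 * δ + a * ((α + β) / 2 * 1) := by
        rw [abs_mul a, abs_of_nonneg ha]
        gcongr
        · exact abs_comb_le hα0.le hβ0.le hdc (by rwa [abs_neg])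
        · exact abs_comb_le hα0.le hβ0.le hc1 hs1
      _ ≤ _ := by rw [mul_one]; exact hmid a ha ha'
  have e2 : |-((β * C - α * S) / 2) + b * ((β * C - α * S) / 2) + β * C -
      (β * C' + α * S') / 2| ≤ 26 * h ^ 3 := by
    have : -((β * C - α * S) / 2) + b * ((β * C - α * S) / 2) + β * C - (β * C' + α * S') / 2 =
        (β * (C - C') + α * (S - S')) / 2 + b * ((β * C + α * (-S)) / 2) := by ring
    rw [this]
    calc _ ≤ |(β * (C - C') + α * (S - S')) / 2| + |b * ((β * C + α * (-S)) / 2)| := abs_add_le _ _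
      _ ≤ (α + β) / 2 * δ + b * ((α + β) / 2 * 1) := by
        rw [abs_mul b, abs_of_nonneg hb]
        gcongr
        · exact abs_comb_le hα0.le hβ0.le hdc hds
        · exact abs_comb_le hα0.le hβ0.le hc1 (by rwa [abs_neg])
      _ ≤ _ := by rw [mul_one]; exact hmid b hb hb'
  linarith

end ReducedWalk

end SimplicialWalk

namespace SimplicialWalk

/-! ### Parameters, initial state and running time of the search -/

section Search

variable {n : ℕ}

/-- The sine of the rotation between the marked arcs and the arcs leaving their endpoints. -/
noncomputable def markedCoupling (n : ℕ) : ℝ := 2 * √(n : ℝ) / (n + 1)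

/-- The sine of the rotation between the arcs entering the marked endpoints and the remaining
arcs. -/
noncomputable def bulkCoupling (n : ℕ) : ℝ := 2 * √(2 * ((n : ℝ) - 1)) / (n + 1)

/-- The angle by which one step of the walk rotates the uniform state towards the marked one. -/
noncomputable def searchAngle (n : ℕ) : ℝ := markedCoupling n * bulkCoupling n / 2

/-- The running time of the search. -/
noncomputable def searchTime (n : ℕ) : ℕ := ⌊Real.pi / 2 / searchAngle n⌋₊

/-- The reduced step with the parameters of the search walk. -/
noncomputable def searchStep (n : ℕ) : EuclideanSpace ℝ (Fin 4) → EuclideanSpace ℝ (Fin 4) :=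
  reducedStep (2 / (n + 1)) (4 / (n + 1)) (markedCoupling n) (bulkCoupling n)

theorem markedCoupling_sq (n : ℕ) :
    markedCoupling n ^ 2 = 2 * (2 / ((n : ℝ) + 1)) - (2 / ((n : ℝ) + 1)) ^ 2 := by
  have hp : √(n : ℝ) ^ 2 = n := Real.sq_sqrt n.cast_nonneg
  rw [markedCoupling, div_pow, mul_pow, hp]
  field_simp
  ring

theorem bulkCoupling_sq (hn : 2 ≤ n) :
    bulkCoupling n ^ 2 = 2 * (4 / ((n : ℝ) + 1)) - (4 / ((n : ℝ) + 1)) ^ 2 := by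
  have hn' : (2 : ℝ) ≤ n := by exact_mod_cast hn
  have hr : √(2 * ((n : ℝ) - 1)) ^ 2 = 2 * ((n : ℝ) - 1) := Real.sq_sqrt (by linarith)
  rw [bulkCoupling, div_pow, mul_pow, hr]
  field_simp
  ring

theorem markedCoupling_pos (hn : 2 ≤ n) : 0 < markedCoupling n := by
  have hn' : (2 : ℝ) ≤ n := by exact_mod_cast hn
  have : 0 < √(n : ℝ) := Real.sqrt_pos.2 (by linarith)
  unfold markedCoupling
  positivity

theorem bulkCoupling_pos (hn : 2 ≤ n) : 0 < bulkCoupling n := by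
  have hn' : (2 : ℝ) ≤ n := by exact_mod_cast hn
  have : 0 < √(2 * ((n : ℝ) - 1)) := Real.sqrt_pos.2 (by linarith)
  unfold bulkCoupling
  positivity

theorem searchAngle_pos (hn : 2 ≤ n) : 0 < searchAngle n :=
  half_pos (mul_pos (markedCoupling_pos hn) (bulkCoupling_pos hn))

theorem sq_inv_sqrt_succ (n : ℕ) : (1 / √((n : ℝ) + 1)) ^ 2 = 1 / (n + 1) := by
  rw [div_pow, Real.sq_sqrt (by positivity), one_pow]

theorem markedCoupling_le (n : ℕ) : markedCoupling n ≤ 3 * (1 / √((n : ℝ) + 1)) := by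
  refine le_of_pow_le_pow_left₀ two_ne_zero (by positivity) ?_
  rw [markedCoupling_sq, mul_pow, sq_inv_sqrt_succ]
  have h : 0 < 1 / ((n : ℝ) + 1) := by positivity
  have e : 2 / ((n : ℝ) + 1) = 2 * (1 / ((n : ℝ) + 1)) := by ring
  rw [e]
  nlinarith [sq_nonneg (1 / ((n : ℝ) + 1))]

theorem bulkCoupling_le (hn : 2 ≤ n) : bulkCoupling n ≤ 3 * (1 / √((n : ℝ) + 1)) := by
  refine le_of_pow_le_pow_left₀ two_ne_zero (by positivity) ?_
  rw [bulkCoupling_sq hn, mul_pow, sq_inv_sqrt_succ]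
  have h : 0 < 1 / ((n : ℝ) + 1) := by positivity
  have e : 4 / ((n : ℝ) + 1) = 4 * (1 / ((n : ℝ) + 1)) := by ring
  rw [e]
  nlinarith [sq_nonneg (1 / ((n : ℝ) + 1))]

theorem le_searchAngle (hn : 2 ≤ n) : 1 / ((n : ℝ) + 1) ≤ searchAngle n := by
  have hn' : (2 : ℝ) ≤ n := by exact_mod_cast hn
  refine le_of_pow_le_pow_left₀ two_ne_zero (searchAngle_pos hn).le ?_
  rw [searchAngle, div_pow (markedCoupling n * bulkCoupling n), mul_pow, markedCoupling_sq, bulkCoupling_sq hn]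
  have e : (2 * (2 / ((n : ℝ) + 1)) - (2 / ((n : ℝ) + 1)) ^ 2) *
      (2 * (4 / ((n : ℝ) + 1)) - (4 / ((n : ℝ) + 1)) ^ 2) / 2 ^ 2 =
      (8 * n * (n - 1) / (n + 1) ^ 2) * (1 / ((n : ℝ) + 1)) ^ 2 := by
    field_simp
    ring
  rw [e]
  refine le_mul_of_one_le_left (by positivity) ?_
  rw [one_le_div (by positivity)]
  nlinarith

theorem searchAngle_le (hn : 2 ≤ n) : searchAngle n ≤ 9 / 2 * (1 / √((n : ℝ) + 1)) ^ 2 := by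
  have h : markedCoupling n * bulkCoupling n ≤
      (3 * (1 / √((n : ℝ) + 1))) * (3 * (1 / √((n : ℝ) + 1))) := by
    have := (bulkCoupling_pos hn).le
    gcongr
    · exact markedCoupling_le n
    · exact bulkCoupling_le hn
  rw [searchAngle]
  nlinarith

theorem searchTime_le (hn : 2 ≤ n) : (searchTime n : ℝ) ≤ 2 * (n + 1) := by
  have h0 := searchAngle_pos hn
  calc (searchTime n : ℝ) ≤ Real.pi / 2 / searchAngle n :=
        Nat.floor_le (div_nonneg (by positivity) h0.le)
    _ ≤ 2 / (1 / ((n : ℝ) + 1)) := by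
        gcongr
        · linarith [Real.pi_le_four]
        · exact le_searchAngle hn
    _ = _ := by field_simp

/-- The state of the walk with orthonormal coordinates `v` in the reduced subspace. -/
noncomputable def reducedState (s : Simplex (sphereComplex n) n) (v : EuclideanSpace ℝ (Fin 4)) :
    EuclideanSpace ℂ (Flag (sphereComplex n) n) :=
  arcState (classAmp s.1 (v 0 / 2) (v 1 / (2 * √(n : ℝ))) (v 2 / (2 * √(n : ℝ)))
    (v 3 / (√(n : ℝ) * √(2 * ((n : ℝ) - 1)))))

/-- The four classes contain `4`, `4 * n`, `4 * n` and `2 * n * (n - 1)` flags; dividing by the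
square roots of these numbers makes the coordinates orthonormal. -/
theorem searchEvolution_reducedState (hn : 2 ≤ n) (s : Simplex (sphereComplex n) n)
    (v : EuclideanSpace ℝ (Fin 4)) :
    searchEvolution s (reducedState s v) = reducedState s (searchStep n v) := by
  have hn' : (2 : ℝ) ≤ n := by exact_mod_cast hn
  have hp0 : 0 < √(n : ℝ) := Real.sqrt_pos.2 (by linarith)
  have hr0 : 0 < √(2 * ((n : ℝ) - 1)) := Real.sqrt_pos.2 (by linarith)
  have hp : √(n : ℝ) ^ 2 = n := Real.sq_sqrt n.cast_nonneg
  have hr : √(2 * ((n : ℝ) - 1)) ^ 2 = 2 * ((n : ℝ) - 1) := Real.sq_sqrt (by linarith)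
  rw [reducedState, searchEvolution_classAmp hn, reducedState]
  simp only [searchStep, reducedStep, markedCoupling, bulkCoupling]
  generalize √(n : ℝ) = p at *
  generalize √(2 * ((n : ℝ) - 1)) = r at *
  have hp1 : p ≠ 0 := hp0.ne'
  have hr1 : r ≠ 0 := hr0.ne'
  have hn1 : (n : ℝ) + 1 ≠ 0 := by positivity
  simp
  congr 2
  · field_simp
    linear_combination (-2 * v 2) * hp
  · field_simp
    ring
  · field_simp
    linear_combination (-2 * v 3) * hr
  · field_simp
    ring

theorem searchEvolution_pow_reducedState (hn : 2 ≤ n) (s : Simplex (sphereComplex n) n)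
    (v : EuclideanSpace ℝ (Fin 4)) (t : ℕ) :
    (searchEvolution s ^ t) (reducedState s v) = reducedState s ((searchStep n)^[t] v) := by
  induction t with
  | zero => simp
  | succ t ih =>
    rw [pow_succ', Module.End.mul_apply, ih, searchEvolution_reducedState hn,
      Function.iterate_succ_apply']

theorem observeProb_reducedState (hn : 2 ≤ n) (s : Simplex (sphereComplex n) n)
    (v : EuclideanSpace ℝ (Fin 4)) : observeProb (reducedState s v) s = v 0 ^ 2 := by
  rw [reducedState, observeProb_classAmp hn]
  ring

/-- The reduced coordinates of the uniform state. -/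
noncomputable def uniformCoords (n : ℕ) : EuclideanSpace ℝ (Fin 4) :=
  !₂[1 / √((n + 2).choose 2 : ℝ), √(n : ℝ) / √((n + 2).choose 2 : ℝ),
    √(n : ℝ) / √((n + 2).choose 2 : ℝ),
    √(n : ℝ) * √(2 * ((n : ℝ) - 1)) / (2 * √((n + 2).choose 2 : ℝ))]

theorem uniformState_eq_reducedState (hn : 2 ≤ n) (s : Simplex (sphereComplex n) n) :
    uniformState (sphereComplex n) n = reducedState s (uniformCoords n) := by
  have hn' : (2 : ℝ) ≤ n := by exact_mod_cast hn
  have hp0 : √(n : ℝ) ≠ 0 := (Real.sqrt_pos.2 (by linarith)).ne'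
  have hr0 : √(2 * ((n : ℝ) - 1)) ≠ 0 := (Real.sqrt_pos.2 (by linarith)).ne'
  rw [uniformState_eq_classAmp hn s, reducedState]
  simp only [uniformCoords]
  generalize √(n : ℝ) = p at *
  generalize √(2 * ((n : ℝ) - 1)) = r at *
  simp
  congr 2 <;> field_simp

theorem cast_choose_two (n : ℕ) : ((n + 2).choose 2 : ℝ) = (n + 1) * (n + 2) / 2 := by
  rw [Nat.cast_choose_two]
  push_cast
  ring

/-- All but `O(1 / n)` of the uniform weight lies on arcs inside `s`, and the other coordinates of
both points are themselves `O(h)`. The constant is `1 + 7 / 2 + 7 / 2 + 4`. -/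
theorem dist_uniformCoords_le (hn : 2 ≤ n) :
    dist (uniformCoords n) (slowCurve (markedCoupling n) (bulkCoupling n) 0) ≤
      12 * (1 / √((n : ℝ) + 1)) := by
  have hn' : (2 : ℝ) ≤ n := by exact_mod_cast hn
  set h : ℝ := 1 / √((n : ℝ) + 1) with hh
  have hhsq : h ^ 2 = 1 / (n + 1) := sq_inv_sqrt_succ n
  have h0 : 0 ≤ h := by positivity
  have h1 : h ≤ 1 := by
    rw [hh, div_le_one (by positivity), Real.one_le_sqrt]
    linarith
  have hβ := bulkCoupling_le hn
  have hβ0 := (bulkCoupling_pos hn).le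
  set β := bulkCoupling n
  have hN : √((n + 2).choose 2 : ℝ) ^ 2 = (n + 1) * (n + 2) / 2 := by
    rw [Real.sq_sqrt (Nat.cast_nonneg _), cast_choose_two]
  have hN0 : 0 < √((n + 2).choose 2 : ℝ) :=
    Real.sqrt_pos.2 (by rw [cast_choose_two]; positivity)
  have hp : √(n : ℝ) ^ 2 = n := Real.sq_sqrt n.cast_nonneg
  have hr : √(2 * ((n : ℝ) - 1)) ^ 2 = 2 * ((n : ℝ) - 1) := Real.sq_sqrt (by linarith)
  have hp0 := Real.sqrt_nonneg (n : ℝ)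
  have hr0 := Real.sqrt_nonneg (2 * ((n : ℝ) - 1))
  refine (dist_le_sum_abs _ _).trans ?_
  simp only [uniformCoords, slowCurve]
  generalize √(n : ℝ) = p at *
  generalize √(2 * ((n : ℝ) - 1)) = r at *
  generalize √((n + 2).choose 2 : ℝ) = R at *
  simp
  have eA : |R|⁻¹ ≤ h := by
    rw [abs_of_pos hN0]
    refine le_of_pow_le_pow_left₀ two_ne_zero h0 ?_
    rw [hhsq, inv_pow, hN, inv_eq_one_div]
    gcongr
    nlinarith
  have eB : |p / R - β / 2| ≤ 7 / 2 * h := by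
    have h2 : p / R ≤ 2 * h := by
      refine le_of_pow_le_pow_left₀ two_ne_zero (by positivity) ?_
      rw [div_pow, mul_pow, hhsq, hp, hN, div_le_iff₀ (by positivity)]
      field_simp
      nlinarith
    have h3 : 0 ≤ p / R := by positivity
    rw [abs_le]
    constructor <;> linarith
  have eD : |p * r / (2 * R) - 1| ≤ 4 * h := by
    set D := p * r / (2 * R) with hD
    have hD0 : 0 ≤ D := by positivity
    have hDsq : 1 - D ^ 2 = (2 * n + 1) * 2 / ((n + 1) * (n + 2)) := by
      rw [hD, div_pow, mul_pow, mul_pow, hN, hp, hr]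
      field_simp
      ring
    have hle : 1 - D ^ 2 ≤ 4 * h := by
      calc 1 - D ^ 2 ≤ 4 * h ^ 2 := by
            rw [hDsq, hhsq, div_le_iff₀ (by positivity)]
            field_simp
            nlinarith
        _ ≤ 4 * h := by nlinarith
    have hpos : 0 ≤ 1 - D ^ 2 := by rw [hDsq]; positivity
    have hD1 : D ≤ 1 := by nlinarith
    -- For `0 ≤ D ≤ 1` one has `1 - D ≤ 1 - D ^ 2`, which avoids the square root.
    rw [abs_sub_comm, abs_of_nonneg (by linarith)]
    nlinarith
  linarith

/-- The constant `321` is `12 + 304 + 5`: initial distance, accumulated step errors, and rounding of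
the running time. -/
theorem abs_searchStep_iterate_sub_one_le (hn : 2 ≤ n) :
    |((searchStep n)^[searchTime n] (uniformCoords n)) 0 - 1| ≤ 321 * (1 / √((n : ℝ) + 1)) := by
  have hn' : (2 : ℝ) ≤ n := by exact_mod_cast hn
  have hhsq := sq_inv_sqrt_succ n
  have hα := markedCoupling_le n
  have hβ := bulkCoupling_le hn
  have hδle := searchAngle_le hn
  have hδ0 := searchAngle_pos hn
  have ht := searchTime_le hn
  have hinit := dist_uniformCoords_le hn
  have h1 : 1 / √((n : ℝ) + 1) ≤ 1 := by
    rw [div_le_one (by positivity), Real.one_le_sqrt]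
    linarith
  have h0 : 0 < 1 / √((n : ℝ) + 1) := by positivity
  generalize 1 / √((n : ℝ) + 1) = h at *
  set w : ℕ → EuclideanSpace ℝ (Fin 4) := fun k =>
    slowCurve (markedCoupling n) (bulkCoupling n) (k * searchAngle n) with hw
  have hstep : ∀ k, dist (searchStep n (w k)) (w (k + 1)) ≤ 152 * h ^ 3 := by
    intro k
    have e : ((k + 1 : ℕ) : ℝ) * searchAngle n =
        k * searchAngle n + markedCoupling n * bulkCoupling n / 2 := by
      push_cast
      rw [← searchAngle]
      ring
    simp only [hw, e]
    refine dist_reducedStep_slowCurve_le (by positivity) (by positivity) (markedCoupling_pos hn)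
      (bulkCoupling_pos hn) (markedCoupling_sq n) (bulkCoupling_sq hn) h1 ?_ ?_ hα hβ _
    · rw [hhsq, mul_one_div]
      gcongr
      norm_num
    · rw [hhsq, mul_one_div]
  have hdist := dist_iterate_le
    (reducedStep_dist (markedCoupling_sq n) (bulkCoupling_sq hn)) hstep (uniformCoords n)
    (searchTime n)
  change dist ((searchStep n)^[searchTime n] (uniformCoords n)) _ ≤ _ at hdist
  set v := (searchStep n)^[searchTime n] (uniformCoords n)
  have hw0 : w 0 = slowCurve (markedCoupling n) (bulkCoupling n) 0 := by simp [hw]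
  rw [hw0] at hdist
  have hcoord : |v 0 - Real.sin (searchTime n * searchAngle n)| ≤
      dist v (w (searchTime n)) := by
    rw [dist_eq_norm]
    have := PiLp.norm_apply_le (v - w (searchTime n)) 0
    simpa [hw, slowCurve] using this
  have hte : (searchTime n : ℝ) * (152 * h ^ 3) ≤ 304 * h := by
    have e : ((n : ℝ) + 1) * h ^ 2 = 1 := by
      rw [hhsq]
      field_simp
    calc (searchTime n : ℝ) * (152 * h ^ 3) ≤ 2 * (n + 1) * (152 * h ^ 3) := by gcongr
      _ = 304 * h * ((n + 1) * h ^ 2) := by ring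
      _ = 304 * h := by rw [e, mul_one]
  -- The floor puts the final angle within one `searchAngle n` of `π / 2`, and that angle is at most
  -- `9 / 2 * h ^ 2 ≤ 5 * h`.
  have hsin : |Real.sin (searchTime n * searchAngle n) - 1| ≤ 5 * h := by
    have hs := Real.abs_sin_sub_sin_le (searchTime n * searchAngle n) (Real.pi / 2)
    rw [Real.sin_pi_div_two] at hs
    refine hs.trans ?_
    have hq : 0 ≤ Real.pi / 2 / searchAngle n := by positivity
    have hf1 : (searchTime n : ℝ) ≤ Real.pi / 2 / searchAngle n := Nat.floor_le hq
    have hf2 : Real.pi / 2 / searchAngle n < searchTime n + 1 := Nat.lt_floor_add_one _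
    rw [le_div_iff₀ hδ0] at hf1
    rw [div_lt_iff₀ hδ0] at hf2
    rw [abs_le]
    constructor <;> nlinarith
  calc |v 0 - 1| ≤ |v 0 - Real.sin (searchTime n * searchAngle n)| +
        |Real.sin (searchTime n * searchAngle n) - 1| := abs_sub_le _ _ _
    _ ≤ _ := by linarith

end Search

end SimplicialWalk

/-! ### The asymptotic statement -/

theorem theorem3p2 :
    ∃ t : ℕ → ℕ,
      (fun n => (t n : ℝ)) =O[Filter.atTop] (fun n => (n : ℝ)) ∧
      (fun n => (t n : ℝ)) =O[Filter.atTop]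
        (fun n => √(Nat.card (SimplicialWalk.Simplex (SimplicialWalk.sphereComplex n) n) : ℝ)) ∧
      ∀ ε : ℝ, 0 < ε → ∃ n₀ : ℕ, 2 ≤ n₀ ∧ ∀ n : ℕ, n₀ ≤ n →
        ∀ s : SimplicialWalk.Simplex (SimplicialWalk.sphereComplex n) n,
          |SimplicialWalk.observeProb
            ((SimplicialWalk.searchEvolution s ^ t n)
              (SimplicialWalk.uniformState (SimplicialWalk.sphereComplex n) n)) s - 1| < ε := by
  refine ⟨SimplicialWalk.searchTime, ?_, ?_, ?_⟩
  · refine Asymptotics.IsBigO.of_bound 3 (Filter.eventually_atTop.2 ⟨2, fun n hn => ?_⟩)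
    have hn' : (2 : ℝ) ≤ n := by exact_mod_cast hn
    rw [Real.norm_natCast, Real.norm_natCast]
    linarith [SimplicialWalk.searchTime_le hn]
  · refine Asymptotics.IsBigO.of_bound 4 (Filter.eventually_atTop.2 ⟨2, fun n hn => ?_⟩)
    rw [Real.norm_natCast, Real.norm_of_nonneg (Real.sqrt_nonneg _),
      SimplicialWalk.card_simplex hn, SimplicialWalk.cast_choose_two]
    have h : ((n : ℝ) + 1) / 2 ≤ √((n + 1) * (n + 2) / 2) := by
      apply Real.le_sqrt_of_sq_le
      nlinarith [(Nat.cast_nonneg n : (0 : ℝ) ≤ n)]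
    linarith [SimplicialWalk.searchTime_le hn]
  · intro ε hε
    have hlim : Filter.Tendsto (fun n : ℕ => 321 * (1 / √((n : ℝ) + 1))) Filter.atTop
        (nhds 0) := by
      have h1 : Filter.Tendsto (fun n : ℕ => √((n : ℝ) + 1)) Filter.atTop Filter.atTop :=
        Real.tendsto_sqrt_atTop.comp
          (Filter.tendsto_atTop_add_const_right _ _ tendsto_natCast_atTop_atTop)
      simpa using (h1.inv_tendsto_atTop.const_mul 321)
    -- The bound `1` gives `|A + 1| ≤ 3` for the marked coordinate `A`, and `ε / 3` then controls
    -- `|A ^ 2 - 1| = |A - 1| * |A + 1|`. The estimate does not involve `s`, whence uniformity.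
    have hev := hlim.eventually (gt_mem_nhds (show (0 : ℝ) < min 1 (ε / 3) by positivity))
    obtain ⟨m, hm⟩ := Filter.eventually_atTop.1 hev
    refine ⟨max m 2, le_max_right _ _, fun n hn s => ?_⟩
    have hn2 : 2 ≤ n := (le_max_right _ _).trans hn
    have hlt := (SimplicialWalk.abs_searchStep_iterate_sub_one_le hn2).trans_lt
      (hm n ((le_max_left _ _).trans hn))
    rw [SimplicialWalk.uniformState_eq_reducedState hn2 s,
      SimplicialWalk.searchEvolution_pow_reducedState hn2,
      SimplicialWalk.observeProb_reducedState hn2]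
    generalize ((SimplicialWalk.searchStep n)^[SimplicialWalk.searchTime n]
      (SimplicialWalk.uniformCoords n)) 0 = A at *
    obtain ⟨h1, h2⟩ := lt_min_iff.1 hlt
    have h3 : |A + 1| ≤ 3 := by
      rw [abs_lt] at h1
      rw [abs_le]
      constructor <;> linarith
    calc |A ^ 2 - 1| = |A - 1| * |A + 1| := by rw [← abs_mul]; ring_nf
      _ ≤ |A - 1| * 3 := by gcongr
      _ < ε := by linarith
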